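/- Let $d\ge 2$ and $1\le n\le d+1$. Let $N=\mathbb{Z}^d$ with standard basis $e_1,\dots,e_d$, and put $x_k:=e_k$ for $1\le k\le d$ and $x_{d+1}:=-(e_1+\cdots+e_d)$. The fan of $\mathbb{P}^d$ consists of the cones generated by the proper subsets of $\{x_1,\dots,x_{d+1}\}$; its torus-invariant points correspond to the $d+1$ maximal cones $\tau_i=\langle x_k : k\ne i\rangle$. Let $B^d_n$ be the blow-up of $\mathbb{P}^d$ at $n$ distinct torus-invariant points, numbered (after relabelling the $x_k$) so that they correspond to $\tau_1,\dots,\tau_n$, and let $\Sigma^d_n$ be its fan, i.e. the fan obtained from the fan of $\mathbb{P}^d$ by successive star subdivisions along $\tau_1,\dots,\tau_n$. Let $y_i$ be the primitive generator of the ray added by the subdivision along $\tau_i$ (the ray of the exceptional divisor over the $i$-th point), that is, the sum of the generators of $\tau_i$. For a fan $\Sigma$ let $G(\Sigma)\subset N$ be the set of primitive generators of its one-dimensional cones. A non-empty subset $P\subset G(\Sigma)$ is a primitive collection if $P$ does not generate a cone of $\Sigma$ but $P\setminus\{u\}$ generates a cone of $\Sigma$ for every $u\in P$. If $\Sigma$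 is the fan of a smooth complete toric variety, the primitive relation of a primitive collection $P=\{u_1,\dots,u_l\}$ is the relation $u_1+\cdots+u_l=a_1v_1+\cdots+a_mv_m$ in $N$ with positive integers $a_1,\dots,a_m$, where $v_1,\dots,v_m\in G(\Sigma)$ are the generators of the unique cone of $\Sigma$ that contains $u_1+\cdots+u_l$ in its relative interior. Then $G(\Sigma^d_n)=\{x_1,\dots,x_{d+1},y_1,\dots,y_n\}$ (these $d+1+n$ vectors are distinct), and the primitive relations of $\Sigma^d_n$ are exactly $$x_i+y_i=0\quad(1\le i\le n),\qquad \sum_{\substack{1\le k\le d+1\\ k\ne i}}x_k=y_i\quad(1\le i\le n),\qquad y_i+y_j=\sum_{\substack{1\le k\le d+1\\ k\ne i,j}}x_k\quad(1\le i<j\le n).$$ In particular, $\Sigma^d_n$ has exactly $\frac{n(n+3)}{2}$ primitive collections. -/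

import Mathlib

noncomputable section

namespace ToricFan

/-- The lattice `N = ℤ^d`. -/
abbrev Lattice (d : ℕ) : Type := Fin d → ℤ

/-- The inclusion of `N = ℤ^d` into `N_ℝ = ℝ^d`. -/
def toReal {d : ℕ} (u : Lattice d) : Fin d → ℝ := fun i => (u i : ℝ)

/-- Convex cones in `N_ℝ = ℝ^d`. A fan is given by its set of cones, a `Set (Cone d)`. -/
abbrev Cone (d : ℕ) : Type := PointedCone ℝ (Fin d → ℝ)

/-- The cone in `N_ℝ` generated by a set of lattice vectors. -/
def cone {d : ℕ} (A : Set (Lattice d)) : Cone d := PointedCone.hull ℝ (toReal '' A)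

/-- A primitive lattice vector: it is not a multiple `m • w`, `m ≠ ± 1`, of a lattice vector
(in particular it is nonzero, since `0 = 2 • 0`). -/
def IsPrimitiveVector {d : ℕ} (u : Lattice d) : Prop :=
  ∀ (m : ℤ) (w : Lattice d), u = m • w → IsUnit m

/-- `G(Σ)`: the primitive generators of the one-dimensional cones of `Σ`. -/
def gens {d : ℕ} (S : Set (Cone d)) : Set (Lattice d) :=
  {u | IsPrimitiveVector u ∧ cone {u} ∈ S}

/-- The primitive generators of the rays of a cone `σ` of the fan `Σ`
(in a fan, the rays of `Σ` that lie in `σ` are exactly the one-dimensional faces of `σ`). -/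
def coneGens {d : ℕ} (S : Set (Cone d)) (σ : Cone d) : Set (Lattice d) :=
  {u | u ∈ gens S ∧ toReal u ∈ σ}

/-- A primitive collection of `Σ`: a nonempty set of generators that does not generate a cone
of `Σ`, while removing any one of its elements leaves a set that generates a cone of `Σ`. -/
def IsPrimitiveCollection {d : ℕ} (S : Set (Cone d)) (P : Finset (Lattice d)) : Prop :=
  P.Nonempty ∧ (P : Set (Lattice d)) ⊆ gens S ∧ cone (P : Set (Lattice d)) ∉ S ∧
    ∀ u ∈ P, cone ((P.erase u : Finset (Lattice d)) : Set (Lattice d)) ∈ S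

/-- `∑ u ∈ P, u = ∑ v, a v • v` is the primitive relation of the primitive collection `P`:
some cone `σ` of `Σ` contains `∑ u ∈ P, u` in its relative interior, the generators of `σ`
are the vectors `v` with `a v ≠ 0`, and the relation holds in `N`.
The positive integers of the relation are the nonzero values of `a`. -/
def IsPrimitiveRelation {d : ℕ} (S : Set (Cone d)) (P : Finset (Lattice d))
    (a : Lattice d →₀ ℕ) : Prop :=
  IsPrimitiveCollection S P ∧
    ∃ σ ∈ S, toReal (∑ u ∈ P, u) ∈ intrinsicInterior ℝ (σ : Set (Fin d → ℝ)) ∧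
      coneGens S σ = (a.support : Set (Lattice d)) ∧
      ∑ u ∈ P, u = a.sum fun v c => c • v

/-- The star subdivision of `Σ` along the cone `τ` with generators `T`, that is, the fan of the
toric blow-up along the orbit closure of `τ`. The cones that do not contain `τ` are kept; a cone
`σ` that contains `τ` is replaced by all cones generated by a set `A` of generators of `σ` and
the new vector `∑ u ∈ T, u`, where `A` does not contain all of `T`. -/
def starSubdivision {d : ℕ} (S : Set (Cone d)) (T : Finset (Lattice d)) : Set (Cone d) :=
  {σ | σ ∈ S ∧ ¬ cone (T : Set (Lattice d)) ≤ σ} ∪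
  {κ | ∃ σ ∈ S, cone (T : Set (Lattice d)) ≤ σ ∧
    ∃ A : Set (Lattice d), A ⊆ insert (∑ u ∈ T, u) (coneGens S σ) ∧
      ¬ (T : Set (Lattice d)) ⊆ A ∧ κ = cone A}

/-- The vectors `x_1 = e_1, …, x_d = e_d, x_{d+1} = -(e_1 + ⋯ + e_d)`. -/
def x (d : ℕ) : Fin (d + 1) → Lattice d :=
  Fin.snoc (α := fun _ => Lattice d) (fun j => Pi.single j 1) (-∑ j : Fin d, Pi.single j 1)

/-- The fan of `ℙ^d`: its cones are generated by the proper subsets of `{x_1, …, x_{d+1}}`. -/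
def projFan (d : ℕ) : Set (Cone d) :=
  {κ | ∃ A : Set (Fin (d + 1)), A ≠ Set.univ ∧ κ = cone (x d '' A)}

/-- The generators `x_k`, `k ≠ i`, of the maximal cone of the fan of `ℙ^d` that corresponds to
the `i`-th torus-invariant point. -/
def pointGens (d : ℕ) (i : Fin (d + 1)) : Finset (Lattice d) :=
  (Finset.univ.erase i).image (x d)

/-- The vector `∑ x_k`, `k ≠ i`, that blowing up the `i`-th torus-invariant point introduces
(it generates the ray of the exceptional divisor). -/
def y (d : ℕ) (i : Fin (d + 1)) : Lattice d := ∑ k ∈ Finset.univ.erase i, x d k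

/-- The fan of the blow-up of `ℙ^d` at the torus-invariant points `p 0, …, p (n - 1)`
(assumed distinct), which are blown up one after the other. -/
def blowUpFan (d : ℕ) : (n : ℕ) → (Fin n → Fin (d + 1)) → Set (Cone d)
  | 0, _ => projFan d
  | n + 1, p =>
      starSubdivision (blowUpFan d n fun i => p i.castSucc) (pointGens d (p (Fin.last n)))

end ToricFan

end

/-!
The fan of the blow-up at the points with index in a set `E` has an explicit description: a set of
generators spans a cone exactly when it contains none of `{x_e, y_e}`, `{x_k : k ≠ e}` and
`{y_e, y_f}` for distinct `e, f ∈ E`, nor all the `x_k` (`IsFace`, `faceFan`). Once this is known,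
the primitive collections are by definition the minimal sets in this list, and for `E ≠ ∅` these
are the three families of the theorem (`isPrimitiveCollection_iff`).

Everything geometric is reduced to one uniqueness statement. As `∑ k, x_k = 0` and `y_e = -x_e`,
each vector is `∑ k, c k • x_k` with `c` unique up to an additive constant, and a vector of the cone
over a face has such a `c` whose positive and negative entries are the coefficients of the `x_k` and,
up to sign, of the `y_k`. The `c` that arise in this way are the reduced ones (`IsReduced`), and a
vector has at most one reduced `c` (`IsReduced.unique`). It follows that a face consists of all the
generators in its cone (`IsFace.mem_of_mem_cone`), which gives the generators of the fan
(`gens_faceFan`) and shows that the star subdivision along the cone of the `i`-th point turns the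
fan for `E` into the one for `insert i E` (`starSubdivision_faceFan`). It also follows that
a vector is a positive combination of the elements of at most one face (`finsupp_eq_of_isFace`);
since positive combinations lie in the relative interior (`finsuppSum_mem_intrinsicInterior`), a
primitive relation is found by exhibiting one such combination (`isPrimitiveRelation_iff_eq`).
-/

namespace ToricFan

/-! ### Coordinates with respect to `x_1, …, x_{d+1}` -/

lemma toReal_injective {d : ℕ} : Function.Injective (toReal : Lattice d → _) := by
  intro u v h
  ext i
  have : (u i : ℝ) = v i := congrFun h i
  exact_mod_cast this

lemma toReal_zero {d : ℕ} : toReal (0 : Lattice d) = 0 := by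
  ext i; simp [toReal]

lemma toReal_neg {d : ℕ} (u : Lattice d) : toReal (-u) = -toReal u := by
  ext i; simp [toReal]

lemma toReal_sum {d : ℕ} {ι : Type*} (s : Finset ι) (f : ι → Lattice d) :
    toReal (∑ k ∈ s, f k) = ∑ k ∈ s, toReal (f k) := by
  ext i; simp [toReal]

lemma toReal_nsmul {d : ℕ} (m : ℕ) (u : Lattice d) : toReal (m • u) = (m : ℝ) • toReal u := by
  ext i; simp [toReal]

/-- The real vector `∑ k, c k • x_k` with coordinates `c`. Since `∑ k, x_k = 0`, the coordinates
of a vector are determined only up to an additive constant. -/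
noncomputable def comb (d : ℕ) (c : Fin (d + 1) → ℝ) : Fin d → ℝ := ∑ k, c k • toReal (x d k)

lemma comb_apply {d : ℕ} (c : Fin (d + 1) → ℝ) (j : Fin d) :
    comb d c j = c j.castSucc - c (Fin.last d) := by
  simp [comb, Fin.sum_univ_castSucc, x, toReal, Finset.sum_apply, Pi.single_apply, sub_eq_add_neg]

lemma comb_add {d : ℕ} (c c' : Fin (d + 1) → ℝ) : comb d (c + c') = comb d c + comb d c' := by
  simp [comb, add_smul, Finset.sum_add_distrib]

lemma comb_smul {d : ℕ} (r : ℝ) (c : Fin (d + 1) → ℝ) : comb d (r • c) = r • comb d c := by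
  simp [comb, mul_smul, Finset.smul_sum]

lemma comb_single {d : ℕ} (k : Fin (d + 1)) (r : ℝ) :
    comb d (Pi.single k r) = r • toReal (x d k) := by
  simp [comb, Pi.single_apply, ite_smul]

lemma exists_eq_add_of_comb_eq {d : ℕ} {c c' : Fin (d + 1) → ℝ} (h : comb d c = comb d c') :
    ∃ t : ℝ, ∀ k, c' k = c k + t := by
  refine ⟨c' (Fin.last d) - c (Fin.last d), fun k => ?_⟩
  induction k using Fin.lastCases with
  | last => ring
  | cast j =>
    have := congrFun h j
    rw [comb_apply, comb_apply] at this
    linarith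

lemma sum_x (d : ℕ) : ∑ k, x d k = 0 := by
  simp [Fin.sum_univ_castSucc, x]

lemma y_eq_neg (d : ℕ) (i : Fin (d + 1)) : y d i = -x d i := by
  rw [y, eq_neg_iff_add_eq_zero, add_comm, Finset.add_sum_erase _ _ (Finset.mem_univ i), sum_x]

/-- `c` is the coordinate vector attached to a cone of the blow-up of `ℙ^d` at the points with
index in `E`: a positive `c k` is a coefficient of `x_k`, and a negative `c k` is, up to sign, a
coefficient of `y_k = -x_k`. The first two clauses say that some generator among the `x_k` is
missing, and, for `e ∈ E`, even one other than `x_e`; the last one allows at most one `y_k`. -/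
def IsReduced {d : ℕ} (E : Set (Fin (d + 1))) (c : Fin (d + 1) → ℝ) : Prop :=
  (∃ k, c k = 0) ∧ (∀ e ∈ E, ∃ k, k ≠ e ∧ c k ≤ 0) ∧
    ∀ k, c k < 0 → k ∈ E ∧ ∀ j, j ≠ k → 0 ≤ c j

/-- A vector has at most one reduced coordinate vector. This is what makes the cones of the
blow-up fit together to a fan. -/
lemma IsReduced.unique {d : ℕ} {E : Set (Fin (d + 1))} {c c' : Fin (d + 1) → ℝ}
    (hc : IsReduced E c) (hc' : IsReduced E c') (h : comb d c = comb d c') : c = c' := by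
  -- A zero of the coordinate vector with the larger constant is a negative entry of the other one,
  -- and then all remaining entries of the larger one are positive.
  have key : ∀ {c c' : Fin (d + 1) → ℝ}, IsReduced E c → IsReduced E c' →
      ∀ t : ℝ, (∀ k, c' k = c k + t) → ¬ 0 < t := by
    rintro c c' ⟨-, -, h3⟩ ⟨⟨k, hk⟩, h2, -⟩ t ht hpos
    have hneg : c k < 0 := by linarith [ht k]
    obtain ⟨hkE, hj⟩ := h3 k hneg
    obtain ⟨j, hjk, hle⟩ := h2 k hkE
    linarith [ht j, hj j hjk]
  obtain ⟨t, ht⟩ := exists_eq_add_of_comb_eq h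
  have h1 := key hc hc' t ht
  have h2 := key hc' hc (-t) fun k => by linarith [ht k]
  ext k
  linarith [ht k]

lemma isReduced_single_one {d : ℕ} (hd : 2 ≤ d) (E : Set (Fin (d + 1))) (k : Fin (d + 1)) :
    IsReduced E (Pi.single k 1) := by
  have hex : ∀ e, ∃ j, j ≠ e ∧ (Pi.single k 1 : Fin (d + 1) → ℝ) j = 0 := by
    intro e
    obtain ⟨j, hj⟩ := Finset.exists_mem_notMem_of_card_lt_card (s := {k, e}) (t := Finset.univ)
      (lt_of_le_of_lt Finset.card_le_two (by simp; omega))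
    simp only [Finset.mem_insert, Finset.mem_singleton, not_or] at hj
    exact ⟨j, hj.2.2, by simp [hj.2.1]⟩
  refine ⟨(hex k).imp fun _ h => h.2, fun e _ => (hex e).imp fun _ h => ⟨h.1, h.2.le⟩, ?_⟩
  intro j hj
  have : (0 : ℝ) ≤ (Pi.single k 1 : Fin (d + 1) → ℝ) j := by
    rw [Pi.single_apply]; split_ifs <;> norm_num
  linarith

lemma isReduced_single_neg_one {d : ℕ} (hd : 2 ≤ d) {E : Set (Fin (d + 1))} {e : Fin (d + 1)}
    (he : e ∈ E) : IsReduced E (Pi.single e (-1)) := by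
  have hex : ∃ j, j ≠ e := by
    have : Nontrivial (Fin (d + 1)) := Fin.nontrivial_iff_two_le.2 (by omega)
    exact exists_ne e
  obtain ⟨j, hj⟩ := hex
  refine ⟨⟨j, by simp [hj]⟩, fun e' _ => ?_, fun k hk => ?_⟩
  · by_cases h : e' = e
    · exact ⟨j, h ▸ hj, by simp [hj]⟩
    · exact ⟨e, Ne.symm h, by simp⟩
  · have hke : k = e := by
      by_contra h
      simp [h] at hk
    exact ⟨hke ▸ he, fun j hj => by simp [hke ▸ hj]⟩

lemma elim_x_y_injective {d : ℕ} (hd : 2 ≤ d) :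
    Function.Injective (Sum.elim (x d) (y d)) := by
  have hx := isReduced_single_one hd Set.univ
  have hy := fun k => isReduced_single_neg_one hd (Set.mem_univ k)
  have cx : ∀ k, comb d (Pi.single k 1) = toReal (x d k) := fun k => by simp [comb_single]
  have cy : ∀ k, comb d (Pi.single k (-1)) = toReal (y d k) := fun k => by
    simp [comb_single, y_eq_neg, toReal_neg]
  rintro (k | k) (l | l) h <;> simp only [Sum.elim_inl, Sum.elim_inr] at h
  · have h' := congrFun ((hx k).unique (hx l) (by rw [cx, cx, h])) k
    by_contra hne
    have : k ≠ l := fun h => hne (by rw [h])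
    simp [this] at h'
  · have h' := congrFun ((hx k).unique (hy l) (by rw [cx, cy, h])) k
    rw [Pi.single_eq_same, Pi.single_apply] at h'
    split_ifs at h' <;> norm_num at h'
  · have h' := congrFun ((hy k).unique (hx l) (by rw [cx, cy, h])) k
    rw [Pi.single_eq_same, Pi.single_apply] at h'
    split_ifs at h' <;> norm_num at h'
  · have h' := congrFun ((hy k).unique (hy l) (by rw [cy, cy, h])) k
    by_contra hne
    have : k ≠ l := fun h => hne (by rw [h])
    simp [this] at h'

lemma x_inj {d : ℕ} (hd : 2 ≤ d) {k l : Fin (d + 1)} : x d k = x d l ↔ k = l :=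
  ⟨fun h => Sum.inl_injective (@elim_x_y_injective d hd (.inl k) (.inl l) h), fun h => h ▸ rfl⟩

lemma y_inj {d : ℕ} (hd : 2 ≤ d) {k l : Fin (d + 1)} : y d k = y d l ↔ k = l :=
  ⟨fun h => Sum.inr_injective (@elim_x_y_injective d hd (.inr k) (.inr l) h), fun h => h ▸ rfl⟩

lemma x_ne_y {d : ℕ} (hd : 2 ≤ d) (k l : Fin (d + 1)) : x d k ≠ y d l :=
  fun h => Sum.inl_ne_inr (@elim_x_y_injective d hd (.inl k) (.inr l) h)

/-! ### The combinatorial model of the blow-up fan -/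

/-- The vectors `x_1, …, x_{d+1}` and `y_e` for `e ∈ E`. -/
def blowUpGens (d : ℕ) (E : Set (Fin (d + 1))) : Set (Lattice d) := Set.range (x d) ∪ y d '' E

/-- `A` is the set of generators of a cone of the blow-up of `ℙ^d` at the points with index
in `E`. The conditions say that `A` contains none of the sets which turn out to be the primitive
collections, and not all `x_k`; the latter matters only for `E = ∅`. -/
structure IsFace {d : ℕ} (E : Set (Fin (d + 1))) (A : Set (Lattice d)) : Prop where
  subset : A ⊆ blowUpGens d E
  not_range : ¬ Set.range (x d) ⊆ A
  not_x_y : ∀ e ∈ E, ¬ (x d e ∈ A ∧ y d e ∈ A)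
  not_compl : ∀ e ∈ E, ¬ x d '' {e}ᶜ ⊆ A
  not_y_y : ∀ e ∈ E, ∀ f ∈ E, e ≠ f → ¬ (y d e ∈ A ∧ y d f ∈ A)

lemma IsFace.mono {d : ℕ} {E : Set (Fin (d + 1))} {A B : Set (Lattice d)} (hB : IsFace E B)
    (h : A ⊆ B) : IsFace E A where
  subset := h.trans hB.subset
  not_range := fun h' => hB.not_range (h'.trans h)
  not_x_y := fun e he h' => hB.not_x_y e he ⟨h h'.1, h h'.2⟩
  not_compl := fun e he h' => hB.not_compl e he (h'.trans h)
  not_y_y := fun e he f hf hef h' => hB.not_y_y e he f hf hef ⟨h h'.1, h h'.2⟩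

/-- The fan of the blow-up of `ℙ^d` at the points with index in `E`, in combinatorial terms. -/
def faceFan (d : ℕ) (E : Set (Fin (d + 1))) : Set (Cone d) := {κ | ∃ A, IsFace E A ∧ κ = cone A}

lemma y_mem_blowUpGens {d : ℕ} (hd : 2 ≤ d) {E : Set (Fin (d + 1))} {e : Fin (d + 1)} :
    y d e ∈ blowUpGens d E ↔ e ∈ E := by
  constructor
  · rintro (⟨k, hk⟩ | ⟨f, hf, hfe⟩)
    · exact absurd hk (x_ne_y hd k e)
    · exact (y_inj hd).1 hfe ▸ hf
  · exact fun h => Or.inr ⟨e, h, rfl⟩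

lemma x_mem_blowUpGens {d : ℕ} (E : Set (Fin (d + 1))) (k : Fin (d + 1)) :
    x d k ∈ blowUpGens d E := Or.inl ⟨k, rfl⟩

lemma y_notMem_image_x {d : ℕ} (hd : 2 ≤ d) (I : Set (Fin (d + 1))) (e : Fin (d + 1)) :
    y d e ∉ x d '' I := by
  rintro ⟨k, -, hk⟩
  exact x_ne_y hd k e hk

lemma x_mem_image_x {d : ℕ} (hd : 2 ≤ d) {I : Set (Fin (d + 1))} {k : Fin (d + 1)} :
    x d k ∈ x d '' I ↔ k ∈ I :=
  Function.Injective.mem_set_image fun _ _ h => (x_inj hd).1 h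

lemma toReal_mem_cone {d : ℕ} {A : Set (Lattice d)} {u : Lattice d} (hu : u ∈ A) :
    toReal u ∈ cone A := Submodule.subset_span ⟨u, hu, rfl⟩

lemma cone_mono {d : ℕ} {A B : Set (Lattice d)} (h : A ⊆ B) : cone A ≤ cone B :=
  Submodule.span_mono (Set.image_mono h)

/-- Since `y_e = -x_e`, a vector of the cone over a set of generators has coordinates whose
positive and negative entries are accounted for by that set. -/
lemma exists_comb_of_mem_cone {d : ℕ} {E : Set (Fin (d + 1))} {A : Set (Lattice d)}
    (hA : A ⊆ blowUpGens d E) {v : Fin d → ℝ} (hv : v ∈ cone A) :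
    ∃ c : Fin (d + 1) → ℝ, comb d c = v ∧ (∀ k, 0 < c k → x d k ∈ A) ∧
      ∀ k, c k < 0 → k ∈ E ∧ y d k ∈ A := by
  induction hv using Submodule.span_induction with
  | mem v hv =>
    obtain ⟨u, hu, rfl⟩ := hv
    rcases hA hu with ⟨k, rfl⟩ | ⟨e, he, rfl⟩
    · refine ⟨Pi.single k 1, by simp [comb_single], fun j hj => ?_, fun j hj => ?_⟩ <;>
        rw [Pi.single_apply] at hj <;> split_ifs at hj with h
      · rwa [h]
      · exact absurd hj (lt_irrefl _)
      · norm_num at hj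
      · exact absurd hj (lt_irrefl _)
    · refine ⟨Pi.single e (-1), by simp [comb_single, y_eq_neg, toReal_neg],
        fun j hj => ?_, fun j hj => ?_⟩ <;>
        rw [Pi.single_apply] at hj <;> split_ifs at hj with h
      · norm_num at hj
      · exact absurd hj (lt_irrefl _)
      · rw [h]; exact ⟨he, hu⟩
      · exact absurd hj (lt_irrefl _)
  | zero => exact ⟨0, by simp [comb], by simp, by simp⟩
  | add v w _ _ hv hw =>
    obtain ⟨c, rfl, h1, h2⟩ := hv
    obtain ⟨c', rfl, h1', h2'⟩ := hw
    refine ⟨c + c', comb_add _ _, fun k hk => ?_, fun k hk => ?_⟩ <;> rw [Pi.add_apply] at hk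
    · rcases lt_or_ge 0 (c k) with h | h
      · exact h1 k h
      · exact h1' k (by linarith)
    · rcases lt_or_ge (c k) 0 with h | h
      · exact h2 k h
      · exact h2' k (by linarith)
  | smul r v _ hv =>
    obtain ⟨c, rfl, h1, h2⟩ := hv
    have hr : (0 : ℝ) ≤ (r : ℝ) := r.2
    refine ⟨(r : ℝ) • c, comb_smul _ _, fun k hk => h1 k ?_, fun k hk => h2 k ?_⟩ <;>
      rw [Pi.smul_apply, smul_eq_mul] at hk
    · exact pos_of_mul_pos_right hk hr
    · by_contra h
      exact absurd (mul_nonneg hr (not_lt.1 h)) (not_le.2 hk)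

lemma IsFace.isReduced {d : ℕ} {E : Set (Fin (d + 1))} {A : Set (Lattice d)} (hA : IsFace E A)
    {c : Fin (d + 1) → ℝ} (h1 : ∀ k, 0 < c k → x d k ∈ A)
    (h2 : ∀ k, c k < 0 → k ∈ E ∧ y d k ∈ A) : IsReduced E c := by
  have hneg : ∀ k, c k < 0 → k ∈ E ∧ ∀ j, j ≠ k → 0 ≤ c j := fun k hk =>
    ⟨(h2 k hk).1, fun j hjk => not_lt.1 fun hj =>
      hA.not_y_y j (h2 j hj).1 k (h2 k hk).1 hjk ⟨(h2 j hj).2, (h2 k hk).2⟩⟩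
  refine ⟨?_, fun e he => ?_, hneg⟩
  · by_contra! h0
    by_cases hn : ∃ k, c k < 0
    · obtain ⟨k, hk⟩ := hn
      refine hA.not_compl k (h2 k hk).1 ?_
      rintro _ ⟨j, hj, rfl⟩
      exact h1 j (lt_of_le_of_ne ((hneg k hk).2 j hj) (h0 j).symm)
    · push Not at hn
      refine hA.not_range ?_
      rintro _ ⟨j, rfl⟩
      exact h1 j (lt_of_le_of_ne (hn j) (h0 j).symm)
  · by_contra! h
    refine hA.not_compl e he ?_
    rintro _ ⟨j, hj, rfl⟩
    exact h1 j (h j hj)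

/-- The only generators that lie in the cone over a face are the elements of the face. -/
lemma IsFace.mem_of_mem_cone {d : ℕ} (hd : 2 ≤ d) {E : Set (Fin (d + 1))} {A : Set (Lattice d)}
    (hA : IsFace E A) {u : Lattice d} (hu : u ∈ blowUpGens d E) (h : toReal u ∈ cone A) :
    u ∈ A := by
  obtain ⟨c, hc, h1, h2⟩ := exists_comb_of_mem_cone hA.subset h
  have hr := hA.isReduced h1 h2
  rcases hu with ⟨k, rfl⟩ | ⟨e, he, rfl⟩
  · have := hr.unique (isReduced_single_one hd E k) (by simp [hc, comb_single])
    exact h1 k (by simp [this])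
  · have := hr.unique (isReduced_single_neg_one hd he)
      (by simp [hc, comb_single, y_eq_neg, toReal_neg])
    exact (h2 e (by simp [this])).2

/-! ### Generators of the fan -/

lemma exists_coord_x {d : ℕ} (hd : 2 ≤ d) (k : Fin (d + 1)) :
    ∃ j, x d k j = 1 ∨ x d k j = -1 := by
  induction k using Fin.lastCases with
  | last => exact ⟨⟨0, by omega⟩, by simp [x]⟩
  | cast j => exact ⟨j, by simp [x]⟩

lemma exists_coord_of_mem_blowUpGens {d : ℕ} (hd : 2 ≤ d) {E : Set (Fin (d + 1))}
    {u : Lattice d} (hu : u ∈ blowUpGens d E) : ∃ j, u j = 1 ∨ u j = -1 := by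
  rcases hu with ⟨k, rfl⟩ | ⟨e, -, rfl⟩
  · exact exists_coord_x hd k
  · obtain ⟨j, hj⟩ := exists_coord_x hd e
    refine ⟨j, ?_⟩
    rw [y_eq_neg, Pi.neg_apply]
    omega

lemma isPrimitiveVector_of_mem_blowUpGens {d : ℕ} (hd : 2 ≤ d) {E : Set (Fin (d + 1))}
    {u : Lattice d} (hu : u ∈ blowUpGens d E) : IsPrimitiveVector u := by
  rintro m w rfl
  obtain ⟨j, hj⟩ := exists_coord_of_mem_blowUpGens hd hu
  rw [Pi.smul_apply, smul_eq_mul] at hj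
  have : IsUnit (m * w j) := by rcases hj with h | h <;> rw [h] <;> simp
  exact isUnit_of_mul_isUnit_left this

lemma isFace_singleton {d : ℕ} (hd : 2 ≤ d) {E : Set (Fin (d + 1))} {u : Lattice d}
    (hu : u ∈ blowUpGens d E) : IsFace E {u} := by
  have hnot : ∀ e, ¬ x d '' {e}ᶜ ⊆ {u} := by
    intro e h
    obtain ⟨j, hj⟩ := Finset.exists_mem_notMem_of_card_lt_card (s := {e}) (t := Finset.univ)
      (by simp; omega)
    obtain ⟨l, hl⟩ := Finset.exists_mem_notMem_of_card_lt_card (s := {j, e}) (t := Finset.univ)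
      (lt_of_le_of_lt Finset.card_le_two (by simp; omega))
    simp only [Finset.mem_insert, Finset.mem_singleton, not_or] at hj hl
    have h1 : x d j = u := h ⟨j, hj.2, rfl⟩
    have h2 : x d l = u := h ⟨l, hl.2.2, rfl⟩
    exact hl.2.1 ((x_inj hd).1 (h2.trans h1.symm))
  refine ⟨by simpa using hu, fun h => hnot 0 ((Set.image_subset_range _ _).trans h), ?_,
    fun e _ => hnot e, ?_⟩
  · rintro e - ⟨h1, h2⟩
    exact x_ne_y hd e e (h1.trans h2.symm)
  · rintro e - f - hef ⟨h1, h2⟩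
    exact hef ((y_inj hd).1 (h1.trans h2.symm))

lemma gens_faceFan {d : ℕ} (hd : 2 ≤ d) (E : Set (Fin (d + 1))) :
    gens (faceFan d E) = blowUpGens d E := by
  ext u
  refine ⟨?_, fun hu => ⟨isPrimitiveVector_of_mem_blowUpGens hd hu, _, isFace_singleton hd hu, rfl⟩⟩
  rintro ⟨hprim, A, hA, hcone⟩
  have hAne : A.Nonempty := by
    by_contra hne
    rw [Set.not_nonempty_iff_eq_empty] at hne
    have hu : toReal u ∈ cone A := hcone ▸ toReal_mem_cone rfl
    rw [hne, cone, Set.image_empty, PointedCone.hull, Submodule.span_empty,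
      Submodule.mem_bot, ← toReal_zero] at hu
    have := hprim 0 0 (by simpa using toReal_injective hu)
    exact not_isUnit_zero this
  obtain ⟨w, hw⟩ := hAne
  have hwu : toReal w ∈ cone {u} := hcone ▸ toReal_mem_cone hw
  rw [cone, Set.image_singleton, PointedCone.hull, Submodule.mem_span_singleton] at hwu
  obtain ⟨t, ht⟩ := hwu
  have ht' : ∀ j, (t : ℝ) * (u j : ℝ) = (w j : ℝ) := fun j => congrFun ht j
  have ht0 : (0 : ℝ) ≤ (t : ℝ) := t.2
  obtain ⟨j, hj⟩ := exists_coord_of_mem_blowUpGens hd (hA.subset hw)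
  have htpos : (0 : ℝ) < (t : ℝ) := by
    refine lt_of_le_of_ne ht0 fun h => ?_
    have h0 := ht' j
    rw [← h, zero_mul] at h0
    have : w j = 0 := by exact_mod_cast h0.symm
    omega
  -- Since `w j = ±1`, the factor `1 / t` between `w` and `u` is the integer `u j * w j`.
  have hww : (w j : ℝ) * (w j : ℝ) = 1 := by
    rcases hj with h | h <;> rw [h] <;> norm_num
  have htm : (t : ℝ) * ((u j * w j : ℤ) : ℝ) = 1 := by
    push_cast
    rw [← mul_assoc, ht', hww]
  have hu : u = (u j * w j) • w := by
    ext l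
    have : (u l : ℝ) = ((u j * w j : ℤ) : ℝ) * (w l : ℝ) := by
      rw [← ht' l, ← mul_assoc, mul_comm _ (t : ℝ), htm, one_mul]
    rw [Pi.smul_apply, smul_eq_mul]
    exact_mod_cast this
  have hpos : 0 < u j * w j := by
    have : (0 : ℝ) < ((u j * w j : ℤ) : ℝ) := pos_of_mul_pos_right (by rw [htm]; norm_num) ht0
    exact_mod_cast this
  have hone : u j * w j = 1 := by
    rcases Int.isUnit_iff.1 (hprim _ _ hu) with h | h
    · exact h
    · omega
  rw [hone, one_smul] at hu
  exact hu ▸ hA.subset hw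

lemma coneGens_faceFan {d : ℕ} (hd : 2 ≤ d) {E : Set (Fin (d + 1))} {A : Set (Lattice d)}
    (hA : IsFace E A) : coneGens (faceFan d E) (cone A) = A := by
  ext u
  rw [coneGens, gens_faceFan hd]
  exact ⟨fun h => hA.mem_of_mem_cone hd h.1 h.2, fun h => ⟨hA.subset h, toReal_mem_cone h⟩⟩

lemma cone_mem_faceFan {d : ℕ} (hd : 2 ≤ d) {E : Set (Fin (d + 1))} {A : Set (Lattice d)}
    (hA : A ⊆ blowUpGens d E) : cone A ∈ faceFan d E ↔ IsFace E A := by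
  refine ⟨?_, fun h => ⟨A, h, rfl⟩⟩
  rintro ⟨B, hB, hAB⟩
  exact hB.mono fun u hu => hB.mem_of_mem_cone hd (hA hu) (hAB ▸ toReal_mem_cone hu)

/-! ### Star subdivisions -/

lemma coe_pointGens (d : ℕ) (i : Fin (d + 1)) :
    (pointGens d i : Set (Lattice d)) = x d '' {i}ᶜ := by
  ext u
  simp [pointGens]

lemma sum_pointGens {d : ℕ} (hd : 2 ≤ d) (i : Fin (d + 1)) : ∑ u ∈ pointGens d i, u = y d i := by
  rw [pointGens, Finset.sum_image fun _ _ _ _ h => (x_inj hd).1 h, y]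

lemma projFan_eq {d : ℕ} (hd : 2 ≤ d) : projFan d = faceFan d ∅ := by
  ext κ
  constructor
  · rintro ⟨I, hI, rfl⟩
    refine ⟨_, ⟨(Set.image_subset_range _ _).trans Set.subset_union_left, fun h => hI ?_,
      by simp, by simp, by simp⟩, rfl⟩
    exact Set.eq_univ_of_forall fun k => (x_mem_image_x hd).1 (h ⟨k, rfl⟩)
  · rintro ⟨A, hA, rfl⟩
    have hsub : A ⊆ Set.range (x d) := by simpa [blowUpGens] using hA.subset
    refine ⟨x d ⁻¹' A, fun h => hA.not_range ?_, by rw [Set.image_preimage_eq_of_subset hsub]⟩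
    rintro _ ⟨k, rfl⟩
    exact (Set.ext_iff.1 h k).2 trivial

lemma starSubdivision_faceFan {d : ℕ} (hd : 2 ≤ d) {E : Set (Fin (d + 1))} {i : Fin (d + 1)}
    (hi : i ∉ E) : starSubdivision (faceFan d E) (pointGens d i) = faceFan d (insert i E) := by
  have hsub : blowUpGens d E ⊆ blowUpGens d (insert i E) :=
    Set.union_subset_union_right _ (Set.image_mono (Set.subset_insert _ _))
  have hTgens : x d '' {i}ᶜ ⊆ blowUpGens d E :=
    (Set.image_subset_range _ _).trans Set.subset_union_left
  have hTB : ∀ {B}, IsFace E B → cone (x d '' {i}ᶜ) ≤ cone B → x d '' {i}ᶜ ⊆ B :=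
    fun hB hle u hu => hB.mem_of_mem_cone hd (hTgens hu) (hle (toReal_mem_cone hu))
  ext κ
  rw [starSubdivision, coe_pointGens, sum_pointGens hd]
  constructor
  · rintro (⟨⟨A, hA, rfl⟩, hT⟩ | ⟨_, ⟨B, hB, rfl⟩, hT, A, hAB, hTA, rfl⟩)
    · have hyA : y d i ∉ A := fun h => hi ((y_mem_blowUpGens hd).1 (hA.subset h))
      refine ⟨A, ⟨hA.subset.trans hsub, hA.not_range, ?_, ?_, ?_⟩, rfl⟩
      · rintro e (rfl | he) h
        · exact hyA h.2
        · exact hA.not_x_y e he h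
      · rintro e (rfl | he) h
        · exact hT (cone_mono h)
        · exact hA.not_compl e he h
      · rintro e (rfl | he) f (rfl | hf) hef h
        · exact hef rfl
        · exact hyA h.1
        · exact hyA h.2
        · exact hA.not_y_y e he f hf hef h
    · rw [coneGens_faceFan hd hB] at hAB
      replace hT := hTB hB hT
      have hyA : ∀ e ∈ insert i E, y d e ∈ A → e = i := by
        intro e he h
        rcases hAB h with h | h
        · exact (y_inj hd).1 h
        · by_contra hei
          exact hB.not_x_y e (he.resolve_left hei) ⟨hT ⟨e, hei, rfl⟩, h⟩
      have hxA : x d i ∉ A := by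
        intro h
        rcases hAB h with h | h
        · exact x_ne_y hd _ _ h
        · refine hB.not_range ?_
          rintro _ ⟨k, rfl⟩
          by_cases hk : k = i
          · exact hk ▸ h
          · exact hT ⟨k, hk, rfl⟩
      refine ⟨A, ⟨?_, fun h => hxA (h ⟨i, rfl⟩), ?_, ?_, ?_⟩, rfl⟩
      · intro u hu
        rcases hAB hu with rfl | h
        · exact (y_mem_blowUpGens hd).2 (Set.mem_insert _ _)
        · exact hsub (hB.subset h)
      · rintro e he ⟨h1, h2⟩
        exact hxA (hyA e he h2 ▸ h1)
      · intro e _ h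
        by_cases hei : e = i
        · exact hTA (hei ▸ h)
        · exact hxA (h ⟨i, Ne.symm hei, rfl⟩)
      · rintro e he f hf hef ⟨h1, h2⟩
        exact hef ((hyA e he h1).trans (hyA f hf h2).symm)
  · rintro ⟨A, hA, rfl⟩
    have hiE : i ∈ insert i E := Set.mem_insert _ _
    by_cases hyA : y d i ∈ A
    · have hT : IsFace E (x d '' {i}ᶜ) := by
        have hxi : x d i ∉ x d '' {i}ᶜ := by simp [x_mem_image_x hd]
        refine ⟨hTgens, fun h => hxi (h ⟨i, rfl⟩), fun e _ h => y_notMem_image_x hd _ _ h.2,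
          fun e he h => hxi (h ⟨i, ?_, rfl⟩), fun e _ f _ _ h => y_notMem_image_x hd _ _ h.1⟩
        rintro rfl
        exact hi he
      refine Or.inr ⟨_, ⟨_, hT, rfl⟩, le_rfl, A, ?_, hA.not_compl i hiE, rfl⟩
      rw [coneGens_faceFan hd hT]
      intro u hu
      rcases hA.subset hu with ⟨k, rfl⟩ | ⟨e, he, rfl⟩
      · refine Or.inr ⟨k, ?_, rfl⟩
        rintro rfl
        exact hA.not_x_y k hiE ⟨hu, hyA⟩
      · refine Or.inl ?_
        by_contra hne
        exact hA.not_y_y e he i hiE (fun h => hne (by rw [h])) ⟨hu, hyA⟩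
    · have hA' : IsFace E A := by
        refine ⟨fun u hu => ?_, hA.not_range, fun e he => hA.not_x_y e (Or.inr he),
          fun e he => hA.not_compl e (Or.inr he),
          fun e he f hf => hA.not_y_y e (Or.inr he) f (Or.inr hf)⟩
        rcases hA.subset hu with h | ⟨e, rfl | he, rfl⟩
        · exact Or.inl h
        · exact absurd hu hyA
        · exact Or.inr ⟨e, he, rfl⟩
      exact Or.inl ⟨⟨A, hA', rfl⟩, fun h => hA.not_compl i hiE (hTB hA' h)⟩

lemma blowUpFan_eq {d : ℕ} (hd : 2 ≤ d) {n : ℕ} {p : Fin n → Fin (d + 1)}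
    (hp : Function.Injective p) : blowUpFan d n p = faceFan d (Set.range p) := by
  induction n with
  | zero => rw [blowUpFan, projFan_eq hd, Set.range_eq_empty]
  | succ n ih =>
    have hq : Function.Injective fun i : Fin n => p i.castSucc :=
      hp.comp (Fin.castSucc_injective n)
    rw [blowUpFan, ih hq, starSubdivision_faceFan hd]
    · congr 1
      ext k
      simp [Fin.exists_fin_succ', or_comm, eq_comm]
    · rintro ⟨j, hj⟩
      exact (Fin.castSucc_lt_last j).ne (hp hj)

/-! ### Relative interiors of cones -/

/-- A vector of a cone from which a small positive multiple of any vector of the cone can be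
subtracted without leaving the cone lies in the relative interior. -/
lemma mem_intrinsicInterior_cone {d : ℕ} {C : Cone d} {v : Fin d → ℝ}
    (h : ∀ w ∈ C, ∃ ε : ℝ, 0 < ε ∧ v - ε • w ∈ C) :
    v ∈ intrinsicInterior ℝ (C : Set (Fin d → ℝ)) := by
  have hvC : v ∈ C := by
    obtain ⟨ε, -, h0⟩ := h 0 C.zero_mem
    simpa using h0
  obtain ⟨w, hw⟩ := Set.Nonempty.intrinsicInterior C.convex ⟨0, C.zero_mem⟩
  obtain ⟨w', hw', rfl⟩ := mem_intrinsicInterior.1 hw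
  obtain ⟨ε, hε, hz⟩ := h w' (intrinsicInterior_subset hw)
  -- The map `q ↦ ε⁻¹ (q - z)`, `z = v - ε w'`, of the affine span takes `v` to the relative
  -- interior point `w'`, and only points of `C` are taken into `C`.
  set z : Fin d → ℝ := v - ε • (w' : Fin d → ℝ) with hzdef
  have hsub := subset_affineSpan ℝ (C : Set (Fin d → ℝ))
  let g : affineSpan ℝ (C : Set (Fin d → ℝ)) → affineSpan ℝ (C : Set (Fin d → ℝ)) := fun q =>
    ⟨ε⁻¹ • ((q : Fin d → ℝ) - z), by
      simpa using AffineSubspace.smul_vsub_vadd_mem _ ε⁻¹ q.2 (hsub hz) (hsub C.zero_mem)⟩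
  have hg : Continuous g := by fun_prop
  have hgv : g ⟨v, hsub hvC⟩ = w' := by
    ext1
    simp [g, hzdef, smul_smul, hε.ne']
  refine mem_intrinsicInterior.2 ⟨⟨v, hsub hvC⟩, mem_interior_iff_mem_nhds.2 ?_, rfl⟩
  rw [mem_interior_iff_mem_nhds, ← hgv] at hw'
  filter_upwards [hg.continuousAt.preimage_mem_nhds hw'] with q hq
  have hq' : ε⁻¹ • ((q : Fin d → ℝ) - z) ∈ C := hq
  have := C.add_mem (C.smul_mem hε.le hq') hz
  rwa [smul_smul, mul_inv_cancel₀ hε.ne', one_smul, sub_add_cancel] at this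

lemma toReal_finsuppSum {d : ℕ} (a : Lattice d →₀ ℕ) :
    toReal (a.sum fun v c => c • v) = ∑ u ∈ a.support, (a u : ℝ) • toReal u := by
  simp only [Finsupp.sum, toReal_sum, toReal_nsmul]

lemma finsuppSum_mem_intrinsicInterior {d : ℕ} (a : Lattice d →₀ ℕ) :
    toReal (a.sum fun v c => c • v) ∈
      intrinsicInterior ℝ (cone (a.support : Set (Lattice d)) : Set (Fin d → ℝ)) := by
  set C := cone (a.support : Set (Lattice d)) with hC
  set v := toReal (a.sum fun v c => c • v) with hv
  have hgen : ∀ u ∈ a.support, toReal u ∈ C := fun u hu => toReal_mem_cone hu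
  have hvC : v ∈ C := by
    rw [hv, toReal_finsuppSum]
    exact C.sum_mem fun u hu => C.smul_mem (Nat.cast_nonneg _) (hgen u hu)
  refine mem_intrinsicInterior_cone fun w hw => ?_
  induction hw using Submodule.span_induction with
  | mem w hw =>
    obtain ⟨u, hu, rfl⟩ := hw
    refine ⟨1, one_pos, ?_⟩
    have h1 : (1 : ℝ) ≤ a u := by
      exact_mod_cast Nat.one_le_iff_ne_zero.2 (Finsupp.mem_support_iff.1 hu)
    have : v - (1 : ℝ) • toReal u = ((a u : ℝ) - 1) • toReal u +
        ∑ u' ∈ a.support.erase u, (a u' : ℝ) • toReal u' := by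
      rw [hv, toReal_finsuppSum, ← Finset.add_sum_erase _ _ hu, sub_smul]
      abel
    rw [this]
    exact C.add_mem (C.smul_mem (by linarith) (hgen u hu)) (C.sum_mem fun u' hu' =>
      C.smul_mem (Nat.cast_nonneg _) (hgen u' (Finset.mem_of_mem_erase hu')))
  | zero => exact ⟨1, one_pos, by simpa using hvC⟩
  | add w₁ w₂ _ _ h₁ h₂ =>
    obtain ⟨s, hs, hs'⟩ := h₁
    obtain ⟨t, ht, ht'⟩ := h₂
    have hst : 0 < s + t := add_pos hs ht
    refine ⟨s * t / (s + t), by positivity, ?_⟩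
    have : v - (s * t / (s + t)) • (w₁ + w₂) =
        (t / (s + t)) • (v - s • w₁) + (s / (s + t)) • (v - t • w₂) := by
      ext j
      simp only [Pi.sub_apply, Pi.add_apply, Pi.smul_apply, smul_eq_mul]
      field_simp
      ring
    rw [this]
    exact C.add_mem (C.smul_mem (by positivity) hs') (C.smul_mem (by positivity) ht')
  | smul r w _ h =>
    obtain ⟨s, hs, hs'⟩ := h
    rcases r.2.eq_or_lt with h0 | h0
    · refine ⟨1, one_pos, ?_⟩
      have : r = 0 := Subtype.ext h0.symm
      simpa [this] using hvC
    · refine ⟨s / (r : ℝ), div_pos hs h0, ?_⟩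
      have : (s / (r : ℝ)) • (r • w) = s • w := by
        change (s / (r : ℝ)) • ((r : ℝ) • w) = s • w
        rw [smul_smul, div_mul_cancel₀ _ h0.ne']
      rwa [this]

/-! ### Primitive relations -/

lemma toReal_finsuppSum_eq_comb {d : ℕ} (hd : 2 ≤ d) {E : Set (Fin (d + 1))}
    {a : Lattice d →₀ ℕ} (ha : (a.support : Set (Lattice d)) ⊆ blowUpGens d E) :
    toReal (a.sum fun v c => c • v) = comb d fun k => (a (x d k) : ℝ) - a (y d k) := by
  have hsub : a.support ⊆ Finset.univ.image (Sum.elim (x d) (y d)) := by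
    intro u hu
    rcases ha hu with ⟨k, rfl⟩ | ⟨e, -, rfl⟩
    · exact Finset.mem_image.2 ⟨.inl k, Finset.mem_univ _, rfl⟩
    · exact Finset.mem_image.2 ⟨.inr e, Finset.mem_univ _, rfl⟩
  have hy : ∀ k, toReal (y d k) = -toReal (x d k) := fun k => by rw [y_eq_neg, toReal_neg]
  rw [Finsupp.sum_of_support_subset a hsub _ (by simp),
    Finset.sum_image fun _ _ _ _ h => elim_x_y_injective hd h, toReal_sum]
  simp only [Fintype.sum_sum_type, Sum.elim_inl, Sum.elim_inr, toReal_nsmul, hy, comb, sub_smul,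
    Finset.sum_sub_distrib, smul_neg, Finset.sum_neg_distrib, ← sub_eq_add_neg]

/-- A lattice vector is a positive integral combination of the generators of at most one cone of
the fan, and in only one way. -/
lemma finsupp_eq_of_isFace {d : ℕ} (hd : 2 ≤ d) {E : Set (Fin (d + 1))} {a b : Lattice d →₀ ℕ}
    (ha : IsFace E (a.support : Set (Lattice d))) (hb : IsFace E (b.support : Set (Lattice d)))
    (h : (a.sum fun v c => c • v) = b.sum fun v c => c • v) : a = b := by
  have hred : ∀ {a : Lattice d →₀ ℕ}, IsFace E (a.support : Set (Lattice d)) →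
      IsReduced E fun k => (a (x d k) : ℝ) - a (y d k) := by
    intro a ha
    refine ha.isReduced (fun k hk => ?_) (fun k hk => ?_)
    · refine Finsupp.mem_support_iff.2 fun h0 => ?_
      rw [h0] at hk
      have : (0 : ℝ) ≤ a (y d k) := Nat.cast_nonneg _
      push_cast at hk
      linarith
    · have hk' : y d k ∈ (a.support : Set (Lattice d)) := by
        refine Finsupp.mem_support_iff.2 fun h0 => ?_
        rw [h0] at hk
        have : (0 : ℝ) ≤ a (x d k) := Nat.cast_nonneg _
        push_cast at hk
        linarith
      exact ⟨(y_mem_blowUpGens hd).1 (ha.subset hk'), hk'⟩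
  have hzero : ∀ {a : Lattice d →₀ ℕ}, IsFace E (a.support : Set (Lattice d)) →
      ∀ k, a (x d k) = 0 ∨ a (y d k) = 0 := by
    intro a ha k
    by_contra! h0
    have hy : y d k ∈ (a.support : Set (Lattice d)) := Finsupp.mem_support_iff.2 h0.2
    exact ha.not_x_y k ((y_mem_blowUpGens hd).1 (ha.subset hy))
      ⟨Finsupp.mem_support_iff.2 h0.1, hy⟩
  have hc := (hred ha).unique (hred hb) (by
    rw [← toReal_finsuppSum_eq_comb hd ha.subset, ← toReal_finsuppSum_eq_comb hd hb.subset, h])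
  have hk : ∀ k, a (x d k) + b (y d k) = b (x d k) + a (y d k) := by
    intro k
    have h' : (a (x d k) : ℝ) - a (y d k) = b (x d k) - b (y d k) := congrFun hc k
    have : (a (x d k) : ℝ) + b (y d k) = b (x d k) + a (y d k) := by linarith
    exact_mod_cast this
  ext u
  by_cases hu : u ∈ blowUpGens d E
  · rcases hu with ⟨k, rfl⟩ | ⟨k, -, rfl⟩ <;>
      · have h1 := hk k
        have h2 := hzero ha k
        have h3 := hzero hb k
        omega
  · have hnot : ∀ {a : Lattice d →₀ ℕ}, IsFace E (a.support : Set (Lattice d)) → a u = 0 :=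
      fun ha => Finsupp.notMem_support_iff.1 fun h => hu (ha.subset h)
    rw [hnot ha, hnot hb]

lemma isPrimitiveRelation_iff_eq {d : ℕ} (hd : 2 ≤ d) {E : Set (Fin (d + 1))}
    {P : Finset (Lattice d)} (hP : IsPrimitiveCollection (faceFan d E) P) {b : Lattice d →₀ ℕ}
    (hb : IsFace E (b.support : Set (Lattice d))) (hsum : ∑ u ∈ P, u = b.sum fun v c => c • v)
    (a : Lattice d →₀ ℕ) : IsPrimitiveRelation (faceFan d E) P a ↔ a = b := by
  constructor
  · rintro ⟨-, _, ⟨A, hA, rfl⟩, -, hgens, ha⟩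
    rw [coneGens_faceFan hd hA] at hgens
    exact finsupp_eq_of_isFace hd (hgens ▸ hA) hb (ha.symm.trans hsum)
  · rintro rfl
    refine ⟨hP, _, ⟨_, hb, rfl⟩, ?_, coneGens_faceFan hd hb, hsum⟩
    rw [hsum]
    exact finsuppSum_mem_intrinsicInterior a

/-! ### Primitive collections -/

lemma isPrimitiveCollection_faceFan {d : ℕ} (hd : 2 ≤ d) {E : Set (Fin (d + 1))}
    {P : Finset (Lattice d)} : IsPrimitiveCollection (faceFan d E) P ↔
      P.Nonempty ∧ (P : Set (Lattice d)) ⊆ blowUpGens d E ∧ ¬ IsFace E (P : Set (Lattice d)) ∧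
        ∀ u ∈ P, IsFace E ((P.erase u : Finset (Lattice d)) : Set (Lattice d)) := by
  rw [IsPrimitiveCollection, gens_faceFan hd]
  refine and_congr_right fun _ => and_congr_right fun hP => ?_
  rw [cone_mem_faceFan hd hP]
  refine and_congr_right fun _ => forall₂_congr fun u _ => cone_mem_faceFan hd ?_
  exact (Finset.coe_subset.2 (Finset.erase_subset _ _)).trans hP

lemma isPrimitiveCollection_pair {d : ℕ} (hd : 2 ≤ d) {E : Set (Fin (d + 1))} {u v : Lattice d}
    (hu : u ∈ blowUpGens d E) (hv : v ∈ blowUpGens d E) (h : ¬ IsFace E {u, v}) :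
    IsPrimitiveCollection (faceFan d E) {u, v} := by
  refine (isPrimitiveCollection_faceFan hd).2 ⟨⟨u, by simp⟩, ?_, by simpa using h, ?_⟩
  · intro w hw
    rcases (by simpa using hw : w = u ∨ w = v) with rfl | rfl <;> assumption
  · intro w hw
    rcases (by simpa using hw : w = u ∨ w = v) with rfl | rfl
    · refine (isFace_singleton hd hv).mono fun z hz => ?_
      obtain ⟨hne, hmem⟩ := Finset.mem_erase.1 (Finset.mem_coe.1 hz)
      exact Finset.mem_singleton.1 ((Finset.mem_insert.1 hmem).resolve_left hne)
    · refine (isFace_singleton hd hu).mono fun z hz => ?_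
      obtain ⟨hne, hmem⟩ := Finset.mem_erase.1 (Finset.mem_coe.1 hz)
      exact (Finset.mem_insert.1 hmem).resolve_right fun h => hne (Finset.mem_singleton.1 h)

lemma isFace_image_compl_pair {d : ℕ} (hd : 2 ≤ d) (E : Set (Fin (d + 1))) {i j : Fin (d + 1)}
    (hij : i ≠ j) : IsFace E (x d '' {i, j}ᶜ) where
  subset := (Set.image_subset_range _ _).trans Set.subset_union_left
  not_range h := by simpa [x_mem_image_x hd] using h ⟨i, rfl⟩
  not_x_y _ _ h := y_notMem_image_x hd _ _ h.2
  not_compl e _ h := by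
    by_cases hei : e = i
    · simpa [x_mem_image_x hd] using h ⟨j, fun h => hij (hei.symm.trans h.symm), rfl⟩
    · simpa [x_mem_image_x hd] using h ⟨i, Ne.symm hei, rfl⟩
  not_y_y _ _ _ _ _ h := y_notMem_image_x hd _ _ h.1

lemma isPrimitiveCollection_pointGens {d : ℕ} (hd : 2 ≤ d) {E : Set (Fin (d + 1))}
    {i : Fin (d + 1)} (hi : i ∈ E) : IsPrimitiveCollection (faceFan d E) (pointGens d i) := by
  have : Nontrivial (Fin (d + 1)) := Fin.nontrivial_iff_two_le.2 (by omega)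
  obtain ⟨j, hj⟩ := exists_ne i
  refine (isPrimitiveCollection_faceFan hd).2 ⟨⟨x d j, by simp [pointGens, x_inj hd, hj]⟩, ?_,
    fun h => h.not_compl i hi (coe_pointGens d i).ge, fun u hu => ?_⟩
  · rw [coe_pointGens]
    exact (Set.image_subset_range _ _).trans Set.subset_union_left
  · obtain ⟨k, hk, rfl⟩ : u ∈ x d '' {i}ᶜ := coe_pointGens d i ▸ hu
    refine (isFace_image_compl_pair hd E (Ne.symm hk)).mono ?_
    rw [Finset.coe_erase, coe_pointGens]
    rintro _ ⟨⟨l, hl, rfl⟩, hlk⟩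
    exact ⟨l, by simpa using ⟨hl, fun h => hlk (h ▸ rfl)⟩, rfl⟩

lemma isPrimitiveCollection_x_y {d : ℕ} (hd : 2 ≤ d) {E : Set (Fin (d + 1))} {i : Fin (d + 1)}
    (hi : i ∈ E) : IsPrimitiveCollection (faceFan d E) {x d i, y d i} :=
  isPrimitiveCollection_pair hd (x_mem_blowUpGens E i) ((y_mem_blowUpGens hd).2 hi)
    fun h => h.not_x_y i hi (by simp)

lemma isPrimitiveCollection_y_y {d : ℕ} (hd : 2 ≤ d) {E : Set (Fin (d + 1))} {i j : Fin (d + 1)}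
    (hi : i ∈ E) (hj : j ∈ E) (hij : i ≠ j) :
    IsPrimitiveCollection (faceFan d E) {y d i, y d j} :=
  isPrimitiveCollection_pair hd ((y_mem_blowUpGens hd).2 hi) ((y_mem_blowUpGens hd).2 hj)
    fun h => h.not_y_y i hi j hj hij (by simp)

lemma isPrimitiveCollection_iff {d : ℕ} (hd : 2 ≤ d) {E : Set (Fin (d + 1))} (hE : E.Nonempty)
    {P : Finset (Lattice d)} : IsPrimitiveCollection (faceFan d E) P ↔
      (∃ i ∈ E, P = {x d i, y d i}) ∨ (∃ i ∈ E, P = pointGens d i) ∨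
        ∃ i ∈ E, ∃ j ∈ E, i ≠ j ∧ P = {y d i, y d j} := by
  constructor
  · intro hP
    obtain ⟨-, hsub, hnot, herase⟩ := (isPrimitiveCollection_faceFan hd).1 hP
    -- A primitive collection is minimal among the sets that are not faces.
    have key : ∀ Q : Finset (Lattice d), IsPrimitiveCollection (faceFan d E) Q → Q ⊆ P → P = Q := by
      intro Q hQ hQP
      by_contra hne
      obtain ⟨u, huP, huQ⟩ := Finset.exists_of_ssubset (hQP.ssubset_of_ne (Ne.symm hne))
      refine ((isPrimitiveCollection_faceFan hd).1 hQ).2.2.1 ((herase u huP).mono ?_)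
      exact Finset.coe_subset.2 (Finset.subset_erase.2 ⟨hQP, huQ⟩)
    have hcompl : ∀ i ∈ E, x d '' {i}ᶜ ⊆ (P : Set (Lattice d)) → P = pointGens d i :=
      fun i hi h => key _ (isPrimitiveCollection_pointGens hd hi)
        (Finset.coe_subset.1 (coe_pointGens d i ▸ h))
    by_contra! hcon
    obtain ⟨h1, h2, h3⟩ := hcon
    refine hnot ⟨hsub, fun h => ?_, fun i hi h => h1 i hi ?_, fun i hi h => h2 i hi (hcompl i hi h),
      fun i hi j hj hij h => h3 i hi j hj hij ?_⟩
    · obtain ⟨i, hi⟩ := hE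
      exact h2 i hi (hcompl i hi ((Set.image_subset_range _ _).trans h))
    · refine key _ (isPrimitiveCollection_x_y hd hi) fun u hu => ?_
      rcases (by simpa using hu : u = x d i ∨ u = y d i) with rfl | rfl
      exacts [h.1, h.2]
    · refine key _ (isPrimitiveCollection_y_y hd hi hj hij) fun u hu => ?_
      rcases (by simpa using hu : u = y d i ∨ u = y d j) with rfl | rfl
      exacts [h.1, h.2]
  · rintro (⟨i, hi, rfl⟩ | ⟨i, hi, rfl⟩ | ⟨i, hi, j, hj, hij, rfl⟩)
    · exact isPrimitiveCollection_x_y hd hi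
    · exact isPrimitiveCollection_pointGens hd hi
    · exact isPrimitiveCollection_y_y hd hi hj hij

lemma isPrimitiveRelation_x_y {d : ℕ} (hd : 2 ≤ d) {E : Set (Fin (d + 1))} {i : Fin (d + 1)}
    (hi : i ∈ E) (a : Lattice d →₀ ℕ) :
    IsPrimitiveRelation (faceFan d E) {x d i, y d i} a ↔ a = 0 := by
  refine isPrimitiveRelation_iff_eq hd (isPrimitiveCollection_x_y hd hi) ?_ ?_ a
  · exact (isFace_singleton hd (x_mem_blowUpGens E i)).mono (by simp)
  · rw [Finset.sum_pair (x_ne_y hd i i), y_eq_neg, add_neg_cancel, Finsupp.sum_zero_index]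

lemma isPrimitiveRelation_pointGens {d : ℕ} (hd : 2 ≤ d) {E : Set (Fin (d + 1))}
    {i : Fin (d + 1)} (hi : i ∈ E) (a : Lattice d →₀ ℕ) :
    IsPrimitiveRelation (faceFan d E) (pointGens d i) a ↔ a = Finsupp.single (y d i) 1 := by
  refine isPrimitiveRelation_iff_eq hd (isPrimitiveCollection_pointGens hd hi) ?_ ?_ a
  · rw [Finsupp.support_single _ one_ne_zero, Finset.coe_singleton]
    exact isFace_singleton hd ((y_mem_blowUpGens hd).2 hi)
  · rw [sum_pointGens hd, Finsupp.sum_single_index (h := fun v c => c • v) (zero_nsmul _), one_nsmul]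

lemma isPrimitiveRelation_y_y {d : ℕ} (hd : 2 ≤ d) {E : Set (Fin (d + 1))} {i j : Fin (d + 1)}
    (hi : i ∈ E) (hj : j ∈ E) (hij : i ≠ j) (a : Lattice d →₀ ℕ) :
    IsPrimitiveRelation (faceFan d E) {y d i, y d j} a ↔
      a = ∑ k ∈ (Finset.univ.erase i).erase j, Finsupp.single (x d k) 1 := by
  refine isPrimitiveRelation_iff_eq hd (isPrimitiveCollection_y_y hd hi hj hij) ?_ ?_ a
  · refine (isFace_image_compl_pair hd E hij).mono fun u hu => ?_
    obtain ⟨k, hk, huk⟩ := Finset.mem_biUnion.1 (Finsupp.support_finsetSum hu)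
    rw [Finsupp.support_single _ one_ne_zero, Finset.mem_singleton] at huk
    have : k ≠ j ∧ k ≠ i := by simpa using hk
    exact ⟨k, by simpa using this.symm, huk.symm⟩
  · rw [← Finsupp.sum_finsetSum_index (h := fun v c => c • v) (fun _ => zero_nsmul _)
        (fun _ _ _ => add_nsmul _ _ _),
      Finset.sum_pair fun h => hij ((y_inj hd).1 h)]
    have h1 := Finset.add_sum_erase Finset.univ (x d) (Finset.mem_univ i)
    have h2 := Finset.add_sum_erase (Finset.univ.erase i) (x d)
      (Finset.mem_erase.2 ⟨hij.symm, Finset.mem_univ j⟩)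
    rw [sum_x, ← h2] at h1
    simp only [Finsupp.sum_single_index, zero_nsmul, one_nsmul]
    rw [y_eq_neg, y_eq_neg, ← sub_eq_zero, ← neg_eq_zero, ← h1]
    abel

lemma ncard_isPrimitiveCollection {d n : ℕ} (hd : 2 ≤ d) (hn : 1 ≤ n) {p : Fin n → Fin (d + 1)}
    (hp : Function.Injective p) :
    {P : Finset (Lattice d) | IsPrimitiveCollection (faceFan d (Set.range p)) P}.ncard =
      n * (n + 3) / 2 := by
  have hyp : Function.Injective fun i => y d (p i) := fun i j h => hp ((y_inj hd).1 h)
  set F₁ : Finset (Finset (Lattice d)) :=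
    Finset.univ.image fun i => {x d (p i), y d (p i)} with hF₁
  set F₂ : Finset (Finset (Lattice d)) := Finset.univ.image fun i => pointGens d (p i) with hF₂
  set F₃ : Finset (Finset (Lattice d)) :=
    (Finset.univ.powersetCard 2).image fun s => s.image fun i => y d (p i) with hF₃
  have hset : {P : Finset (Lattice d) | IsPrimitiveCollection (faceFan d (Set.range p)) P} =
      ((F₁ ∪ (F₂ ∪ F₃) : Finset _) : Set (Finset (Lattice d))) := by
    ext P
    have h3 : P ∈ F₃ ↔ ∃ i j, p i ≠ p j ∧ P = {y d (p i), y d (p j)} := by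
      simp only [hF₃, Finset.mem_image, Finset.mem_powersetCard_univ, Finset.card_eq_two]
      constructor
      · rintro ⟨_, ⟨i, j, hij, rfl⟩, rfl⟩
        exact ⟨i, j, hp.ne hij, by simp [Finset.image_insert]⟩
      · rintro ⟨i, j, hij, rfl⟩
        exact ⟨_, ⟨i, j, fun h => hij (h ▸ rfl), rfl⟩, by simp [Finset.image_insert]⟩
    rw [Set.mem_ofPred_eq, isPrimitiveCollection_iff hd (Set.range_nonempty_iff_nonempty.2 ⟨⟨0, hn⟩⟩)]
    simp [h3, hF₁, hF₂, eq_comm]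
  have hx₁ : ∀ {P}, P ∈ F₁ → ∃ i, x d i ∈ P := by
    intro P h
    obtain ⟨i, -, rfl⟩ := Finset.mem_image.1 h
    exact ⟨p i, by simp⟩
  have hy₁ : ∀ {P}, P ∈ F₁ → ∃ i, y d i ∈ P := by
    intro P h
    obtain ⟨i, -, rfl⟩ := Finset.mem_image.1 h
    exact ⟨p i, by simp⟩
  have hy₂ : ∀ {P}, P ∈ F₂ → ∀ i, y d i ∉ P := by
    intro P h i hi
    obtain ⟨j, -, rfl⟩ := Finset.mem_image.1 h
    exact y_notMem_image_x hd {p j}ᶜ i (coe_pointGens d (p j) ▸ hi)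
  have hx₃ : ∀ {P}, P ∈ F₃ → ∀ i, x d i ∉ P := by
    intro P h i hi
    obtain ⟨s, -, rfl⟩ := Finset.mem_image.1 h
    obtain ⟨j, -, hj⟩ := Finset.mem_image.1 hi
    exact x_ne_y hd i (p j) hj.symm
  have hy₃ : ∀ {P}, P ∈ F₃ → ∃ i, y d i ∈ P := by
    intro P h
    obtain ⟨s, hs, rfl⟩ := Finset.mem_image.1 h
    obtain ⟨i, hi⟩ : s.Nonempty := by
      rw [← Finset.card_pos, (Finset.mem_powersetCard.1 hs).2]
      norm_num
    exact ⟨p i, Finset.mem_image_of_mem _ hi⟩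
  have hd₂₃ : Disjoint F₂ F₃ := Finset.disjoint_left.2 fun P h2 h3 =>
    (hy₃ h3).elim fun i hi => hy₂ h2 i hi
  have hd₁ : Disjoint F₁ (F₂ ∪ F₃) := by
    refine Finset.disjoint_left.2 fun P h1 h => ?_
    rcases Finset.mem_union.1 h with h2 | h3
    · exact (hy₁ h1).elim fun i hi => hy₂ h2 i hi
    · exact (hx₁ h1).elim fun i hi => hx₃ h3 i hi
  have hc₁ : F₁.card = n := by
    rw [hF₁, Finset.card_image_of_injective, Finset.card_univ, Fintype.card_fin]
    intro i j h
    have hi : x d (p i) ∈ ({x d (p j), y d (p j)} : Finset (Lattice d)) := by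
      have h' : ({x d (p i), y d (p i)} : Finset (Lattice d)) = {x d (p j), y d (p j)} := h
      simp [← h']
    exact hp (by simpa [x_inj hd, x_ne_y hd] using hi)
  have hc₂ : F₂.card = n := by
    rw [hF₂, Finset.card_image_of_injective, Finset.card_univ, Fintype.card_fin]
    intro i j h
    by_contra hij
    have hi : x d (p i) ∈ pointGens d (p j) := by
      simpa [pointGens, x_inj hd] using hp.ne hij
    have h' : pointGens d (p i) = pointGens d (p j) := h
    rw [← h'] at hi
    simp [pointGens, x_inj hd] at hi
  have hc₃ : F₃.card = n.choose 2 := by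
    rw [hF₃, Finset.card_image_of_injective _ (Finset.image_injective hyp),
      Finset.card_powersetCard, Finset.card_univ, Fintype.card_fin]
  rw [hset, Set.ncard_coe_finset, Finset.card_union_of_disjoint hd₁,
    Finset.card_union_of_disjoint hd₂₃, hc₁, hc₂, hc₃, Nat.choose_two_right]
  obtain ⟨m, rfl⟩ := Nat.exists_eq_add_of_le' hn
  have : (m + 1) * (m + 1 + 3) = (m + 1) * m + 4 * (m + 1) := by ring
  rw [Nat.add_sub_cancel, this]
  omega

end ToricFan

theorem proposition3p1 (d n : ℕ) (hd : 2 ≤ d) (hn : 1 ≤ n)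
    (p : Fin n → Fin (d + 1)) (hp : Function.Injective p) :
    -- the generators are the `d + 1 + n` distinct vectors `x_1, …, x_{d+1}, y_1, …, y_n`
    Function.Injective (Sum.elim (ToricFan.x d) fun i : Fin n => ToricFan.y d (p i)) ∧
    ToricFan.gens (ToricFan.blowUpFan d n p) =
      Set.range (Sum.elim (ToricFan.x d) fun i : Fin n => ToricFan.y d (p i)) ∧
    -- the primitive relations
    (∀ (P : Finset (ToricFan.Lattice d)) (a : ToricFan.Lattice d →₀ ℕ),
      ToricFan.IsPrimitiveRelation (ToricFan.blowUpFan d n p) P a ↔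
        (∃ i : Fin n, P = {ToricFan.x d (p i), ToricFan.y d (p i)} ∧ a = 0) ∨
        (∃ i : Fin n, P = (Finset.univ.erase (p i)).image (ToricFan.x d) ∧
          a = Finsupp.single (ToricFan.y d (p i)) 1) ∨
        (∃ i j : Fin n, i < j ∧ P = {ToricFan.y d (p i), ToricFan.y d (p j)} ∧
          a = ∑ k ∈ (Finset.univ.erase (p i)).erase (p j),
            Finsupp.single (ToricFan.x d k) 1)) ∧
    -- the number of primitive collections
    {P : Finset (ToricFan.Lattice d) |
      ToricFan.IsPrimitiveCollection (ToricFan.blowUpFan d n p) P}.ncard = n * (n + 3) / 2 := by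
  rw [ToricFan.blowUpFan_eq hd hp]
  have hmem : ∀ i, p i ∈ Set.range p := fun i => ⟨i, rfl⟩
  refine ⟨?_, ?_, fun P a => ⟨fun hR => ?_, ?_⟩, ToricFan.ncard_isPrimitiveCollection hd hn hp⟩
  · have : Function.Injective (Sum.map (id : Fin (d + 1) → _) p) :=
      Function.injective_id.sumMap hp
    convert (ToricFan.elim_x_y_injective hd).comp this using 1
    ext s : 1
    cases s <;> rfl
  · rw [ToricFan.gens_faceFan hd, ToricFan.blowUpGens, Set.Sum.elim_range, ← Set.range_comp]
    rfl
  · rcases (ToricFan.isPrimitiveCollection_iff hd ⟨_, hmem ⟨0, hn⟩⟩).1 hR.1 with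
      ⟨_, ⟨i, rfl⟩, rfl⟩ | ⟨_, ⟨i, rfl⟩, rfl⟩ | ⟨_, ⟨i, rfl⟩, _, ⟨j, rfl⟩, hij, rfl⟩
    · exact Or.inl ⟨i, rfl, (ToricFan.isPrimitiveRelation_x_y hd (hmem i) a).1 hR⟩
    · exact Or.inr (Or.inl ⟨i, rfl, (ToricFan.isPrimitiveRelation_pointGens hd (hmem i) a).1 hR⟩)
    · refine Or.inr (Or.inr ?_)
      rcases lt_or_gt_of_ne (fun h => hij (h ▸ rfl) : i ≠ j) with h | h
      · exact ⟨i, j, h, rfl,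
          (ToricFan.isPrimitiveRelation_y_y hd (hmem i) (hmem j) hij a).1 hR⟩
      · rw [Finset.pair_comm] at hR
        exact ⟨j, i, h, Finset.pair_comm _ _,
          (ToricFan.isPrimitiveRelation_y_y hd (hmem j) (hmem i) hij.symm a).1 hR⟩
  · rintro (⟨i, rfl, ha⟩ | ⟨i, rfl, ha⟩ | ⟨i, j, hij, rfl, ha⟩)
    · exact (ToricFan.isPrimitiveRelation_x_y hd (hmem i) a).2 ha
    · exact (ToricFan.isPrimitiveRelation_pointGens hd (hmem i) a).2 ha
    · exact (ToricFan.isPrimitiveRelation_y_y hd (hmem i) (hmem j) (hp.ne hij.ne) a).2 ha
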